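/- Let $R$ be a commutative ring with identity. An ideal $I$ is dense if $\{r\in R\mid Ir=0\}=0$, and semi-regular if it contains a finitely generated dense ideal; $\mathcal{Q}$ is the set of finitely generated semi-regular ideals of $R$. A GV-ideal is a finitely generated ideal $J$ such that the natural map $R\to\mathrm{Hom}_R(J,R)$ is an isomorphism. An $R$-module $M$ is GV-torsion (resp. GV-torsion-free) if every (resp. no nonzero) element of $M$ is annihilated by some GV-ideal. A $w$-module is a GV-torsion-free module $M$ with $\mathrm{Ext}^1_R(R/J,M)=0$ for every GV-ideal $J$. Let $E(M)$ denote the injective envelope of $M$. For an ideal $I$ of $R$, put $I_w=\{x\in E(R)\mid Jx\subseteq I \text{ for some GV-ideal } J\}$. A maximal $w$-ideal is an ideal maximal among the proper ideals of $R$ that are $w$-modules (such an ideal is prime). A homomorphism is a $w$-monomorphism (resp. $w$-epimorphism) if its localization at every maximal $w$-ideal is injective (resp. surjective), and a sequence is $w$-exact if its localization at every maximal $w$-ideal is exact. A module $M$ is $w$-flat if $f\otimes_R M$ is a $w$-monomorphism for every $w$-monomorphism $f$, and semi-regular $w$-flat if $\mathrm{Tor}_1^R(R/I,M)$ is GV-torsion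 for every $I\in\mathcal{Q}$. The dimension $sr\text{-}w\text{-}\mathrm{fd}_R(M)\in\mathbb{N}\cup\{\infty\}$ is the least $n$ for which there is a $w$-exact sequence $0\to F_n\to\cdots\to F_0\to M\to 0$ with $F_i$ $w$-flat for $i<n$ and $F_n$ semi-regular $w$-flat ($\infty$ if there is none), and $sr\text{-}w\text{-}\mathrm{w.gl.dim}(R)$ is the supremum of $sr\text{-}w\text{-}\mathrm{fd}_R(M)$ over all $R$-modules $M$. A module $M$ is a Lucas module if it is $\mathcal{Q}$-torsion-free (that is, $Im=0$ with $I\in\mathcal{Q}$, $m\in M$ implies $m=0$) and $\{x\in E(M)\mid Ix\subseteq M\text{ for some } I\in\mathcal{Q}\}=M$. Finally, let $Q_0(R)=\{\alpha\in T(R[x])\mid I\alpha\subseteq R\text{ for some } I\in\mathcal{Q}\}$, where $T(R[x])$ is the total quotient ring of $R[x]$. Theorem. The following statements are equivalent: \begin{enumerate} \item $R$ is a WQ-ring, i.e. every $I\in\mathcal{Q}$ is a GV-ideal; \item every $R$-module is semi-regular $w$-flat; \item $sr\text{-}w\text{-}\mathrm{w.gl.dim}(R)=0$; \item $R/I$ is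 a $w$-flat $R$-module for every $I\in\mathcal{Q}$; \item $I\subseteq (I^2)_w$ for every $I\in\mathcal{Q}$; \item every $w$-module is a Lucas module; \item $Q_0(R)=R$. \end{enumerate} -/

import Mathlib

universe u

namespace WQ

open CategoryTheory

/-! ### Dense and semi-regular ideals, and GV-ideals -/

section Ideals

variable (R : Type u) [CommRing R]

/-- An ideal `I` is dense if `(0 :_R I) = {r ∈ R | I r = 0}` is zero. -/
def IsDense (I : Ideal R) : Prop :=
  ∀ r : R, (∀ a ∈ I, a * r = 0) → r = 0

/-- An ideal is semi-regular if it contains a finitely generated dense sub-ideal. -/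
def IsSemiregular (I : Ideal R) : Prop :=
  ∃ I₀ : Ideal R, I₀ ≤ I ∧ I₀.FG ∧ IsDense R I₀

/-- The set `𝒬` of all finitely generated semi-regular ideals. -/
def Q : Set (Ideal R) := {I | I.FG ∧ IsSemiregular R I}

/-- The natural homomorphism `R → Hom_R(J, R)`, `r ↦ (a ↦ r a)`. -/
def toHom (J : Ideal R) : R →ₗ[R] (J →ₗ[R] R) where
  toFun r := r • J.subtype
  map_add' r s := add_smul r s _
  map_smul' r s := mul_smul r s _

/-- The set of Glaz–Vasconcelos ideals: finitely generated ideals `J` such that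
`R → Hom_R(J, R)` is an isomorphism. -/
def GV : Set (Ideal R) := {J | J.FG ∧ Function.Bijective (toHom R J)}

/-- A WQ-ring: every finitely generated semi-regular ideal is a GV-ideal. -/
def IsWQRing : Prop := ∀ I ∈ Q R, I ∈ GV R

variable {R}

theorem toHom_apply {J : Ideal R} (r : R) (a : J) : toHom R J r a = r * a := rfl

theorem IsDense.mul {I J : Ideal R} (hI : IsDense R I) (hJ : IsDense R J) :
    IsDense R (I * J) := by
  intro r hr
  refine hJ r fun b hb => hI _ fun a ha => ?_
  rw [← mul_assoc]
  exact hr _ (Ideal.mul_mem_mul ha hb)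

theorem Q_mul {I J : Ideal R} (hI : I ∈ Q R) (hJ : J ∈ Q R) : I * J ∈ Q R := by
  obtain ⟨h1, I₀, hle, hfg, hd⟩ := hI
  obtain ⟨h1', J₀, hle', hfg', hd'⟩ := hJ
  exact ⟨h1.mul h1', I₀ * J₀, Ideal.mul_mono hle hle', hfg.mul hfg', hd.mul hd'⟩

theorem top_mem_Q : (⊤ : Ideal R) ∈ Q R := by
  have h : (⊤ : Ideal R).FG := ⟨{1}, by simp⟩
  refine ⟨h, ⊤, le_rfl, h, fun r hr => ?_⟩
  simpa using hr 1 trivial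

theorem top_mem_GV : (⊤ : Ideal R) ∈ GV R := by
  refine ⟨⟨{1}, by simp⟩, fun r s h => ?_, fun f => ⟨f ⟨1, trivial⟩, ?_⟩⟩
  · simpa [toHom_apply] using LinearMap.congr_fun h ⟨1, trivial⟩
  · ext ⟨a, ha⟩
    rw [toHom_apply, mul_comm, ← smul_eq_mul, ← map_smul]
    congr 1
    ext
    simp

theorem isDense_of_mem_GV {J : Ideal R} (hJ : J ∈ GV R) : IsDense R J := by
  intro r hr
  apply hJ.2.1
  ext ⟨a, ha⟩
  rw [toHom_apply, map_zero, mul_comm]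
  exact hr a ha

theorem GV_mul {I J : Ideal R} (hI : I ∈ GV R) (hJ : J ∈ GV R) : I * J ∈ GV R := by
  have hd := (isDense_of_mem_GV hI).mul (isDense_of_mem_GV hJ)
  refine ⟨hI.1.mul hJ.1, fun r s h => ?_, fun f => ?_⟩
  · rw [← sub_eq_zero]
    refine hd _ fun a ha => ?_
    have := LinearMap.congr_fun h ⟨a, ha⟩
    simp only [toHom_apply] at this
    rw [mul_sub, mul_comm a r, mul_comm a s, this, sub_self]
  · let g (a : I) : J →ₗ[R] R :=
      { toFun := fun b => f ⟨a * b, Ideal.mul_mem_mul a.2 b.2⟩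
        map_add' := fun b c => by
          rw [← map_add]; congr 1; ext; simp [mul_add]
        map_smul' := fun r b => by
          rw [RingHom.id_apply, ← map_smul]; congr 1; ext; simp [mul_left_comm] }
    have hg : ∀ a : I, ∃ r : R, ∀ b : J, r * b = f ⟨a * b, Ideal.mul_mem_mul a.2 b.2⟩ := by
      intro a
      obtain ⟨r, hr⟩ := hJ.2.2 (g a)
      exact ⟨r, fun b => LinearMap.congr_fun hr b⟩
    choose φ hφ using hg
    have key : ∀ x y : R, (∀ b : J, x * b = y * b) → x = y := by
      intro x y h
      apply hJ.2.1
      ext b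
      exact h b
    let φ' : I →ₗ[R] R :=
      { toFun := φ
        map_add' := fun a c => by
          refine key _ _ fun b => ?_
          rw [add_mul, hφ, hφ, hφ, ← map_add]; congr 1; ext; simp [add_mul]
        map_smul' := fun r a => by
          refine key _ _ fun b => ?_
          rw [RingHom.id_apply, smul_eq_mul, mul_assoc, hφ, hφ, ← smul_eq_mul (a := r), ← map_smul]
          congr 1; ext; simp [mul_assoc] }
    obtain ⟨r, hr⟩ := hI.2.2 φ'
    refine ⟨r, ?_⟩
    ext ⟨x, hx⟩
    rw [toHom_apply]
    refine Submodule.mul_induction_on' (C := fun x hx => r * x = f ⟨x, hx⟩) ?_ ?_ hx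
    · intro a ha b hb
      have h1 : r * a = φ ⟨a, ha⟩ := LinearMap.congr_fun hr ⟨a, ha⟩
      rw [← mul_assoc, h1]
      exact hφ ⟨a, ha⟩ ⟨b, hb⟩
    · intro x hx y hy h1 h2
      rw [mul_add, h1, h2, ← map_add]
      rfl

end Ideals

/-! ### Injective envelopes -/

section Envelope

variable (R : Type u) [CommRing R]

/-- `i : M → E` is an injective envelope of `M`: `E` is an injective module and `i` is an
essential monomorphism. -/
structure IsInjectiveEnvelope {M E : Type u} [AddCommGroup M] [Module R M]
    [AddCommGroup E] [Module R E] (i : M →ₗ[R] E) : Prop where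
  injective_module : Module.Injective R E
  injective : Function.Injective i
  essential : ∀ x : E, x ≠ 0 → ∃ r : R, r • x ≠ 0 ∧ r • x ∈ LinearMap.range i

theorem exists_injectiveEnvelope (M : Type u) [AddCommGroup M] [Module R M] :
    ∃ (E : ModuleCat.{u} R) (i : M →ₗ[R] E), IsInjectiveEnvelope R i := by
  -- `Q'` is an injective module containing `M`
  obtain ⟨⟨J₀, hJ₀, f₀, hf₀⟩⟩ := EnoughInjectives.presentation (ModuleCat.of R M)
  obtain ⟨Q', hQ, j, hj⟩ :
      ∃ (Q' : ModuleCat.{u} R) (_ : Module.Injective R Q') (j : M →ₗ[R] Q'),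
        Function.Injective j :=
    ⟨J₀, Module.injective_module_of_injective_object R J₀ (inj := hJ₀), f₀.hom,
      (ModuleCat.mono_iff_injective _).1 hf₀⟩
  -- `K` is a maximal essential extension of `M` in `Q'`
  let P : Set (Submodule R Q') := {K | LinearMap.range j ≤ K ∧
    ∀ x ∈ K, x ≠ 0 → ∃ r : R, r • x ≠ 0 ∧ r • x ∈ LinearMap.range j}
  obtain ⟨K, -, hK⟩ : ∃ K, LinearMap.range j ≤ K ∧ Maximal (· ∈ P) K := by
    refine zorn_le_nonempty₀ P (fun c hc hchain y hy => ⟨sSup c, ⟨?_, ?_⟩, fun z => le_sSup⟩)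
      (LinearMap.range j) ⟨le_rfl, fun x hx h0 => ⟨1, by simpa using h0, by simpa using hx⟩⟩
    · exact (hc hy).1.trans (le_sSup hy)
    · intro x hx h0
      obtain ⟨z, hz, hxz⟩ := (Submodule.mem_sSup_of_directed ⟨y, hy⟩ hchain.directedOn).1 hx
      exact (hc hz).2 x hxz h0
  -- `N` is a maximal submodule of `Q'` meeting `K` trivially
  obtain ⟨N, -, hN⟩ : ∃ N, ⊥ ≤ N ∧ Maximal (fun N : Submodule R Q' => Disjoint K N) N := by
    refine zorn_le_nonempty₀ {N | Disjoint K N}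
      (fun c hc hchain y hy => ⟨sSup c, ?_, fun z => le_sSup⟩) ⊥ disjoint_bot_right
    refine Submodule.disjoint_def.2 fun x hxK hx => ?_
    obtain ⟨z, hz, hxz⟩ := (Submodule.mem_sSup_of_directed ⟨y, hy⟩ hchain.directedOn).1 hx
    exact Submodule.disjoint_def.1 (hc hz) x hxK hxz
  have hKN := Submodule.disjoint_def.1 hN.1
  -- every nonzero element of `Q'/N` has a nonzero multiple in the image of `K`
  have hess : ∀ x : Q', x ∉ N → ∃ (r : R) (k : Q'), k ∈ K ∧ k ≠ 0 ∧ r • x - k ∈ N := by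
    intro x hx
    by_contra! hcon
    apply hx
    have : Disjoint K (N ⊔ R ∙ x) := by
      refine Submodule.disjoint_def.2 fun k hk hk' => ?_
      obtain ⟨n, hn, y, hy, rfl⟩ := Submodule.mem_sup.1 hk'
      obtain ⟨r, rfl⟩ := Submodule.mem_span_singleton.1 hy
      by_contra h0
      refine hcon r _ hk h0 ?_
      rw [sub_add_cancel_right]
      exact N.neg_mem hn
    exact hN.2 this le_sup_left (le_sup_right (a := N) (Submodule.mem_span_singleton_self x))
  let q : K →ₗ[R] (Q' ⧸ N) := N.mkQ.comp K.subtype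
  have hq : Function.Injective q := by
    rw [injective_iff_map_eq_zero]
    intro k hk
    exact Subtype.ext (hKN k k.2 ((Submodule.Quotient.mk_eq_zero N).1 hk))
  obtain ⟨g, hg⟩ := hQ.out q hq K.subtype
  have hg' : ∀ k ∈ K, g (N.mkQ k) = k := fun k hk => hg ⟨k, hk⟩
  have hrange : LinearMap.range g = K := by
    refine le_antisymm (hK.2 ⟨fun x hx => ?_, ?_⟩ fun k hk => ⟨_, hg' k hk⟩)
      fun k hk => ⟨_, hg' k hk⟩
    · exact ⟨_, hg' x (hK.1.1 hx)⟩
    · rintro _ ⟨y, rfl⟩ h0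
      obtain ⟨x, rfl⟩ := N.mkQ_surjective y
      have hxN : x ∉ N := fun h => h0 (by
        rw [(Submodule.Quotient.mk_eq_zero N).2 h |> fun h => (h : N.mkQ x = 0), map_zero])
      obtain ⟨r, k, hk, hk0, hrk⟩ := hess x hxN
      have e : r • g (N.mkQ x) = k := by
        rw [← map_smul, ← map_smul, ← hg' k hk, ← sub_eq_zero, ← map_sub, ← map_sub]
        rw [(Submodule.Quotient.mk_eq_zero N).2 hrk |> fun h => (h : N.mkQ (r • x - k) = 0),
          map_zero]
      obtain ⟨s, hs0, hs⟩ := hK.1.2 k hk hk0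
      exact ⟨s * r, by rwa [mul_smul, e], by rwa [mul_smul, e]⟩
  -- hence `K` is a retract of `Q'`
  let π : Q' →ₗ[R] K := (g.comp N.mkQ).codRestrict K fun x => hrange ▸ ⟨_, rfl⟩
  have hπ : ∀ k : K, π k = k := fun k => Subtype.ext (hg' k k.2)
  refine ⟨ModuleCat.of R K, j.codRestrict K fun x => hK.1.1 ⟨x, rfl⟩, ⟨fun X Y _ _ _ _ f hf φ => ?_⟩,
    fun x y h => hj (congrArg Subtype.val h), ?_⟩
  · obtain ⟨h, hh⟩ := hQ.out f hf (K.subtype.comp φ)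
    exact ⟨π.comp h, fun x => by rw [LinearMap.comp_apply, hh]; exact hπ _⟩
  · rintro ⟨x, hx⟩ h0
    obtain ⟨r, hr0, m, hm⟩ := hK.1.2 x hx fun h => h0 (Subtype.ext h)
    exact ⟨r, fun h => hr0 (congrArg Subtype.val h), m, Subtype.ext hm⟩

variable (M : Type u) [AddCommGroup M] [Module R M]

/-- The injective envelope `E(M)` (unique up to isomorphism over `M`). -/
noncomputable def injEnv : ModuleCat.{u} R := (exists_injectiveEnvelope R M).choose

/-- The embedding `M → E(M)`. -/
noncomputable def injEnvι : M →ₗ[R] injEnv R M := (exists_injectiveEnvelope R M).choose_spec.choose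

theorem injEnv_spec : IsInjectiveEnvelope R (injEnvι R M) :=
  (exists_injectiveEnvelope R M).choose_spec.choose_spec

end Envelope

/-! ### GV-torsion, `w`-modules and `w`-envelopes, Lucas modules -/

section Modules

variable (R : Type u) [CommRing R] (M : Type u) [AddCommGroup M] [Module R M]

/-- `tor_GV(M) = {x ∈ M | J x = 0 for some J ∈ GV(R)}`. -/
def torGV : Submodule R M where
  carrier := {x | ∃ J ∈ GV R, ∀ a ∈ J, a • x = 0}
  zero_mem' := ⟨⊤, top_mem_GV, fun a _ => smul_zero a⟩
  add_mem' := fun {x y} h₁ h₂ => by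
    obtain ⟨I, hI, hx⟩ := h₁
    obtain ⟨J, hJ, hy⟩ := h₂
    refine ⟨I * J, GV_mul hI hJ, fun a ha => ?_⟩
    rw [smul_add, hx a (Ideal.mul_le_left ha), hy a (Ideal.mul_le_right ha), add_zero]
  smul_mem' := by
    rintro r x ⟨J, hJ, hx⟩
    exact ⟨J, hJ, fun a ha => by rw [smul_comm, hx a ha, smul_zero]⟩

def IsGVTorsion : Prop := torGV R M = ⊤

def IsGVTorsionFree : Prop := torGV R M = ⊥

/-- A `w`-module: GV-torsion-free with `Ext¹_R(R/J, M) = 0` for every GV-ideal `J`. -/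
def IsWModule : Prop :=
  IsGVTorsionFree R M ∧
    ∀ J ∈ GV R, Subsingleton (Abelian.Ext (ModuleCat.of R (R ⧸ J)) (ModuleCat.of R M) 1)

variable {M} in
/-- The `w`-envelope `N_w = {x ∈ E(M) | J x ⊆ N for some J ∈ GV(R)}` of a submodule `N` of a
GV-torsion-free module `M`, computed inside `E(M)`. Here `E(N)` is a direct summand of `E(M)`
with GV-torsion-free complement, so such `x` automatically lie in `E(N)`. Inclusions between
`w`-envelopes of submodules of `M` (for instance of ideals of `R`) are taken in `E(M)`. -/
noncomputable def wEnvelope (N : Submodule R M) : Submodule R (injEnv R M) where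
  carrier := {x | ∃ J ∈ GV R, ∀ a ∈ J, a • x ∈ N.map (injEnvι R M)}
  zero_mem' := ⟨⊤, top_mem_GV, fun a _ => by rw [smul_zero]; exact Submodule.zero_mem _⟩
  add_mem' := fun {x y} h₁ h₂ => by
    obtain ⟨I, hI, hx⟩ := h₁
    obtain ⟨J, hJ, hy⟩ := h₂
    refine ⟨I * J, GV_mul hI hJ, fun a ha => ?_⟩
    rw [smul_add]
    exact Submodule.add_mem _ (hx a (Ideal.mul_le_left ha)) (hy a (Ideal.mul_le_right ha))
  smul_mem' := by
    rintro r x ⟨J, hJ, hx⟩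
    exact ⟨J, hJ, fun a ha => by rw [smul_comm]; exact Submodule.smul_mem _ _ (hx a ha)⟩

/-- `M` is `𝒬`-torsion-free: `I m = 0` with `I ∈ 𝒬` implies `m = 0`. -/
def IsQTorsionFree : Prop :=
  ∀ I ∈ Q R, ∀ m : M, (∀ a ∈ I, a • m = 0) → m = 0

/-- The Lucas envelope `M_q = {x ∈ E(M) | I x ⊆ M for some I ∈ 𝒬}`. -/
noncomputable def lucasEnvelope : Submodule R (injEnv R M) where
  carrier := {x | ∃ I ∈ Q R, ∀ a ∈ I, a • x ∈ LinearMap.range (injEnvι R M)}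
  zero_mem' := ⟨⊤, top_mem_Q, fun a _ => by rw [smul_zero]; exact Submodule.zero_mem _⟩
  add_mem' := fun {x y} h₁ h₂ => by
    obtain ⟨I, hI, hx⟩ := h₁
    obtain ⟨J, hJ, hy⟩ := h₂
    refine ⟨I * J, Q_mul hI hJ, fun a ha => ?_⟩
    rw [smul_add]
    exact Submodule.add_mem _ (hx a (Ideal.mul_le_left ha)) (hy a (Ideal.mul_le_right ha))
  smul_mem' := by
    rintro r x ⟨J, hJ, hx⟩
    exact ⟨J, hJ, fun a ha => by rw [smul_comm]; exact Submodule.smul_mem _ _ (hx a ha)⟩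

/-- A Lucas module: `𝒬`-torsion-free with `M_q = M`. -/
def IsLucas : Prop :=
  IsQTorsionFree R M ∧ lucasEnvelope R M = LinearMap.range (injEnvι R M)

end Modules

/-! ### Maximal `w`-ideals, `w`-exactness, `w`-flatness -/

section WExact

variable (R : Type u) [CommRing R]

/-- A maximal `w`-ideal: maximal among the proper ideals of `R` that are `w`-modules. -/
def IsMaximalWIdeal (m : Ideal R) : Prop :=
  Maximal (fun I : Ideal R => I ≠ ⊤ ∧ IsWModule R I) m

variable {A B C : Type u} [AddCommGroup A] [Module R A] [AddCommGroup B] [Module R B]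
  [AddCommGroup C] [Module R C]

/-- The localization `f_𝔭 : A_𝔭 → B_𝔭` at a prime ideal. -/
noncomputable def locMap (p : Ideal R) [p.IsPrime] (f : A →ₗ[R] B) :
    LocalizedModule p.primeCompl A →ₗ[R] LocalizedModule p.primeCompl B :=
  IsLocalizedModule.map p.primeCompl (LocalizedModule.mkLinearMap p.primeCompl A)
    (LocalizedModule.mkLinearMap p.primeCompl B) f

/-- `f_𝔪` is injective for every maximal `w`-ideal `𝔪`. (Maximal `w`-ideals are prime; the
primality binder only serves to form the localization.) -/
def IsWMono (f : A →ₗ[R] B) : Prop :=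
  ∀ (m : Ideal R) [m.IsPrime], IsMaximalWIdeal R m → Function.Injective (locMap R m f)

/-- `f_𝔪` is surjective for every maximal `w`-ideal `𝔪`. -/
def IsWEpi (f : A →ₗ[R] B) : Prop :=
  ∀ (m : Ideal R) [m.IsPrime], IsMaximalWIdeal R m → Function.Surjective (locMap R m f)

/-- `A → B → C` is `w`-exact: `A_𝔪 → B_𝔪 → C_𝔪` is exact for every maximal `w`-ideal `𝔪`. -/
def IsWExact (f : A →ₗ[R] B) (g : B →ₗ[R] C) : Prop :=
  ∀ (m : Ideal R) [m.IsPrime], IsMaximalWIdeal R m → Function.Exact (locMap R m f) (locMap R m g)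

/-- `M` is `w`-flat: tensoring with `M` preserves `w`-monomorphisms. -/
def IsWFlat (M : Type u) [AddCommGroup M] [Module R M] : Prop :=
  ∀ (A B : Type u) [AddCommGroup A] [Module R A] [AddCommGroup B] [Module R B] (f : A →ₗ[R] B),
    IsWMono R f → IsWMono R (f.rTensor M)

/-- `M` is semi-regular `w`-flat: `Tor₁^R(R/I, M)` is GV-torsion for all `I ∈ 𝒬`. -/
def IsSRWFlat (M : Type u) [AddCommGroup M] [Module R M] : Prop :=
  ∀ I ∈ Q R, IsGVTorsion R
    (((Tor (ModuleCat.{u} R) 1).obj (ModuleCat.of R (R ⧸ I))).obj (ModuleCat.of R M))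

/-! ### The semi-regular `w`-flat dimension -/

/-- A `w`-exact sequence `0 → F n → ⋯ → F 1 → F 0 → M → 0` with `F i` `w`-flat for `i < n` and
`F n` semi-regular `w`-flat. The sequence is indexed by all of `ℕ`, with `F i = 0` for `i > n`. -/
structure SRWResolution (M : Type u) [AddCommGroup M] [Module R M] (n : ℕ) where
  F : ℕ → ModuleCat.{u} R
  d : ∀ i, F (i + 1) →ₗ[R] F i
  ε : F 0 →ₗ[R] M
  wEpi : IsWEpi R ε
  wExact_zero : IsWExact R (d 0) ε
  wExact_succ : ∀ i, IsWExact R (d (i + 1)) (d i)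
  wFlat : ∀ i < n, IsWFlat R (F i)
  srwFlat : IsSRWFlat R (F n)
  eq_zero : ∀ i, n < i → Subsingleton (F i)

/-- `sr-w-fd_R(M)`: the least length of a semi-regular `w`-flat `w`-resolution of `M`, and `∞` if
there is none. -/
noncomputable def srwFD (M : Type u) [AddCommGroup M] [Module R M] : ℕ∞ :=
  ⨅ (n : ℕ) (_ : Nonempty (SRWResolution R M n)), (n : ℕ∞)

/-- `sr-w-w.gl.dim(R) = sup {sr-w-fd_R(M) | M an R-module}`. -/
noncomputable def srwWeakGlobalDim : ℕ∞ := ⨆ M : ModuleCat.{u} R, srwFD R M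

end WExact

/-! ### The ring of finite fractions -/

section FiniteFractions

open Polynomial

variable (R : Type u) [CommRing R]

/-- The ring of finite fractions
`Q₀(R) = {α ∈ T(R[x]) | I α ⊆ R for some I ∈ 𝒬}`, as an `R`-subalgebra of the total quotient ring
`T(R[x])` of `R[x]`. -/
noncomputable def Q₀ : Subalgebra R (FractionRing R[X]) where
  carrier := {α | ∃ I ∈ Q R, ∀ a ∈ I,
    algebraMap R (FractionRing R[X]) a * α ∈ Set.range (algebraMap R (FractionRing R[X]))}
  mul_mem' := fun {α β} h₁ h₂ => by
    obtain ⟨I, hI, hα⟩ := h₁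
    obtain ⟨J, hJ, hβ⟩ := h₂
    refine ⟨I * J, Q_mul hI hJ, fun c hc => ?_⟩
    refine Submodule.mul_induction_on hc ?_ ?_
    · intro a ha b hb
      obtain ⟨r, hr⟩ := hα a ha
      obtain ⟨s, hs⟩ := hβ b hb
      exact ⟨r * s, by rw [map_mul, map_mul, hr, hs]; ring⟩
    · rintro x y ⟨r, hr⟩ ⟨s, hs⟩
      exact ⟨r + s, by rw [map_add, map_add, hr, hs]; ring⟩
  add_mem' := fun {α β} h₁ h₂ => by
    obtain ⟨I, hI, hα⟩ := h₁
    obtain ⟨J, hJ, hβ⟩ := h₂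
    refine ⟨I * J, Q_mul hI hJ, fun c hc => ?_⟩
    obtain ⟨r, hr⟩ := hα c (Ideal.mul_le_left hc)
    obtain ⟨s, hs⟩ := hβ c (Ideal.mul_le_right hc)
    exact ⟨r + s, by rw [map_add, hr, hs]; ring⟩
  algebraMap_mem' r := ⟨⊤, top_mem_Q, fun a _ => ⟨a * r, by rw [map_mul]⟩⟩

end FiniteFractions

end WQ

/-!
The condition `I ⊆ (I²)_w` is the hub. It only involves `wClosure (I ^ 2)`, the part of `(I²)_w`
inside `R`, and it forces `I ∈ 𝒬` to be a GV-ideal: since `I` is finitely generated, a single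
GV-ideal `J` satisfies `J I ⊆ I²`; the determinant trick and the density of `I` then put a power of
each `j ∈ J`, hence a power of `J`, inside `I` (`mem_GV_of_le_wClosure_sq`), and a finitely
generated ideal containing a GV-ideal is a GV-ideal (`mem_GV_of_le`).

Both homological conditions lead to it because `I/I²` is at once `Tor₁(R/I, R/I)` and `I ⊗ R/I`.
If `R/I` is `w`-flat, the zero map `I ⊗ R/I → R/I` is a `w`-monomorphism, so `I/I²` is GV-torsion.
If `R/I` has a semi-regular `w`-flat resolution `F → R/I` of length zero, then
`mul_mem_wClosure_sq_of_isGVTorsion_tor` carries the GV-torsion of `Tor₁(R/I, F)` over to `I/I²`.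
The passage from localizations at maximal `w`-ideals to GV-torsion is `exists_GV_smul_eq_zero`: an
ideal without GV-subideals lies in a maximal `w`-ideal (`exists_le_isMaximalWIdeal`). Conversely, if
`I` is a GV-ideal, it annihilates `Tor₁(R/I, M)` and `A ⊗ R/I`, and it lies in no maximal `w`-ideal.

The remaining two conditions say in other languages that every homomorphism `I → R` with `I ∈ 𝒬` is
a multiplication. Such a homomorphism is always multiplication by an element of the injective
envelope `E(R)`, and also by a finite fraction in `T(R[x])`, McCoy's theorem providing the regular
denominator; these elements lie in `R` if `R` is a Lucas module, respectively if `Q₀(R) = R`. For a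
WQ-ring, `Ext¹(R/I, M) = 0` expresses that homomorphisms `I → M` extend to `R`
(`subsingleton_ext_quotient_iff`), so that all `w`-modules are Lucas modules.
-/

namespace WQ

open CategoryTheory

/-! ### GV-ideals and GV-torsion -/

section GVIdeals

variable {R : Type u} [CommRing R]

theorem isDense_of_mem_Q {I : Ideal R} (hI : I ∈ Q R) : IsDense R I := by
  obtain ⟨-, I₀, hle, -, hd⟩ := hI
  exact fun r hr => hd r fun a ha => hr a (hle ha)

theorem toHom_injective {J : Ideal R} (hJ : IsDense R J) : Function.Injective (toHom R J) := by
  rw [injective_iff_map_eq_zero]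
  refine fun r hr => hJ r fun a ha => ?_
  simpa [mul_comm, toHom_apply] using LinearMap.congr_fun hr ⟨a, ha⟩

theorem mem_GV_iff_of_mem_Q {I : Ideal R} (hI : I ∈ Q R) :
    I ∈ GV R ↔ Function.Surjective (toHom R I) :=
  ⟨fun h => h.2.2, fun h => ⟨hI.1, toHom_injective (isDense_of_mem_Q hI), h⟩⟩

theorem mem_GV_of_le {I J : Ideal R} (hJ : J ∈ GV R) (hI : I.FG) (hle : J ≤ I) : I ∈ GV R := by
  have hd : IsDense R I := fun r hr => isDense_of_mem_GV hJ r fun a ha => hr a (hle ha)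
  refine ⟨hI, toHom_injective hd, fun f => ?_⟩
  obtain ⟨r, hr⟩ := hJ.2.2 (f.comp (Submodule.inclusion hle))
  refine ⟨r, LinearMap.ext fun a => ?_⟩
  rw [toHom_apply, ← sub_eq_zero]
  -- on `J` the map `f` is multiplication by `r`, and `j * f a = f (j * a) = a * f j`
  refine isDense_of_mem_GV hJ _ fun j hj => ?_
  have h₁ : r * j = f ⟨j, hle hj⟩ := LinearMap.congr_fun hr ⟨j, hj⟩
  have h₂ : j * f a = a * f ⟨j, hle hj⟩ := by
    rw [← smul_eq_mul, ← smul_eq_mul, ← map_smul, ← map_smul]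
    congr 1
    ext
    exact mul_comm _ _
  rw [mul_sub, h₂, ← h₁]
  ring

theorem GV_pow {J : Ideal R} (hJ : J ∈ GV R) (n : ℕ) : J ^ n ∈ GV R := by
  induction n with
  | zero => simpa using top_mem_GV
  | succ n ih => rw [pow_succ]; exact GV_mul ih hJ

theorem isGVTorsion_iff {M : Type u} [AddCommGroup M] [Module R M] :
    IsGVTorsion R M ↔ ∀ x : M, ∃ J ∈ GV R, ∀ a ∈ J, a • x = 0 :=
  Submodule.eq_top_iff'

theorem isGVTorsionFree_iff {M : Type u} [AddCommGroup M] [Module R M] :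
    IsGVTorsionFree R M ↔ ∀ J ∈ GV R, ∀ x : M, (∀ a ∈ J, a • x = 0) → x = 0 := by
  rw [IsGVTorsionFree, Submodule.eq_bot_iff]
  exact ⟨fun h J hJ x hx => h x ⟨J, hJ, hx⟩, fun h x ⟨J, hJ, hx⟩ => h J hJ x hx⟩

theorem isGVTorsionFree_self : IsGVTorsionFree R R :=
  isGVTorsionFree_iff.2 fun _ hJ x hx => isDense_of_mem_GV hJ x hx

/-- A finitely generated GV-torsion submodule is annihilated by a single GV-ideal. -/
theorem exists_GV_smul_eq_zero_of_FG {M : Type u} [AddCommGroup M] [Module R M]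
    {N : Submodule R M} (hN : N.FG) (h : N ≤ torGV R M) :
    ∃ J ∈ GV R, ∀ a ∈ J, ∀ x ∈ N, a • x = 0 := by
  induction N, hN using Submodule.fg_induction with
  | singleton x =>
    obtain ⟨J, hJ, hx⟩ := h (Submodule.mem_span_singleton_self x)
    refine ⟨J, hJ, fun a ha y hy => ?_⟩
    obtain ⟨r, rfl⟩ := Submodule.mem_span_singleton.1 hy
    rw [smul_comm, hx a ha, smul_zero]
  | sup N₁ N₂ _ _ h₁ h₂ =>
    obtain ⟨J, hJ, h₁⟩ := h₁ (le_sup_left.trans h)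
    obtain ⟨K, hK, h₂⟩ := h₂ (le_sup_right.trans h)
    refine ⟨J * K, GV_mul hJ hK, fun a ha x hx => ?_⟩
    obtain ⟨y, hy, z, hz, rfl⟩ := Submodule.mem_sup.1 hx
    rw [smul_add, h₁ a (Ideal.mul_le_left ha) y hy, h₂ a (Ideal.mul_le_right ha) z hz, add_zero]

/-- The quotient of a module by its GV-torsion submodule is GV-torsion-free. -/
theorem mem_torGV_of_forall_smul_mem {M : Type u} [AddCommGroup M] [Module R M] {J : Ideal R}
    (hJ : J ∈ GV R) {x : M} (hx : ∀ a ∈ J, a • x ∈ torGV R M) : x ∈ torGV R M := by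
  obtain ⟨K, hK, h⟩ := exists_GV_smul_eq_zero_of_FG
    (N := Submodule.map (LinearMap.toSpanSingleton R M x) J) (Submodule.FG.map _ hJ.1)
    (Submodule.map_le_iff_le_comap.2 hx)
  refine ⟨K * J, GV_mul hK hJ, fun c hc => ?_⟩
  refine Submodule.mul_induction_on hc (fun b hb a ha => ?_) fun a b ha hb => by
    rw [add_smul, ha, hb, add_zero]
  rw [mul_smul]
  exact h b hb _ (Submodule.mem_map_of_mem ha)

/-- The `w`-closure of an ideal `I` in `R`: the elements `x` with `J x ⊆ I` for some GV-ideal `J`.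
It is `I_w ∩ R`. -/
def wClosure (I : Ideal R) : Ideal R := (torGV R (R ⧸ I)).comap I.mkQ

theorem mem_wClosure {I : Ideal R} {x : R} :
    x ∈ wClosure I ↔ ∃ J ∈ GV R, ∀ a ∈ J, a * x ∈ I := by
  refine exists_congr fun J => and_congr_right fun _ => forall₂_congr fun a _ => ?_
  rw [← map_smul, Submodule.mkQ_apply, Submodule.Quotient.mk_eq_zero, smul_eq_mul]

theorem le_wClosure (I : Ideal R) : I ≤ wClosure I := fun _ hx =>
  mem_wClosure.2 ⟨⊤, top_mem_GV, fun a _ => I.mul_mem_left a hx⟩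

theorem mem_wClosure_of_forall_mul_mem {I J : Ideal R} (hJ : J ∈ GV R) {x : R}
    (hx : ∀ a ∈ J, a * x ∈ wClosure I) : x ∈ wClosure I :=
  mem_torGV_of_forall_smul_mem hJ hx

theorem wClosure_eq_top_iff {I : Ideal R} : wClosure I = ⊤ ↔ ∃ J ∈ GV R, J ≤ I := by
  simp [Ideal.eq_top_iff_one, mem_wClosure, SetLike.le_def]

theorem exists_GV_mul_le_of_le_wClosure {I K : Ideal R} (hI : I.FG) (h : I ≤ wClosure K) :
    ∃ J ∈ GV R, J * I ≤ K := by
  obtain ⟨J, hJ, h'⟩ := exists_GV_smul_eq_zero_of_FG (Submodule.FG.map K.mkQ hI)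
    (Submodule.map_le_iff_le_comap.2 h)
  refine ⟨J, hJ, Ideal.mul_le.2 fun a ha x hx => ?_⟩
  rw [← smul_eq_mul, ← Submodule.Quotient.mk_eq_zero]
  exact h' a ha _ (Submodule.mem_map_of_mem hx)

end GVIdeals

/-! ### `w`-modules and extension of homomorphisms from GV-ideals -/

section WModules

variable {R : Type u} [CommRing R]

/-- By the long exact sequence of `0 → J → R → R/J → 0`, the vanishing of `Ext¹(R/J, M)` means that
every homomorphism `J → M` extends to `R`, that is, has the form `a ↦ a • m`. -/
theorem subsingleton_ext_quotient_iff (J : Ideal R) (M : Type u) [AddCommGroup M] [Module R M] :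
    Subsingleton (Abelian.Ext (ModuleCat.of R (R ⧸ J)) (ModuleCat.of R M) 1) ↔
      ∀ f : J →ₗ[R] M, ∃ m : M, ∀ a : J, f a = (a : R) • m := by
  let S : ShortComplex (ModuleCat.{u} R) :=
    ModuleCat.shortComplexOfCompEqZero J.subtype J.mkQ
      (LinearMap.exact_subtype_mkQ J).linearMap_comp_eq_zero
  have hS : S.ShortExact := ModuleCat.shortComplex_shortExact _
    (LinearMap.exact_subtype_mkQ J) J.injective_subtype J.mkQ_surjective
  have : Projective S.X₂ := inferInstanceAs (Projective (ModuleCat.of R R))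
  constructor
  · intro h f
    obtain ⟨x, hx⟩ := Abelian.Ext.contravariant_sequence_exact₁ hS (ModuleCat.of R M)
      (Abelian.Ext.mk₀ (ModuleCat.ofHom f)) (add_zero 1) (h.elim _ _)
    obtain ⟨g, rfl⟩ := (Abelian.Ext.mk₀_bijective _ _).2 x
    rw [Abelian.Ext.mk₀_comp_mk₀] at hx
    have hg := (Abelian.Ext.mk₀_bijective _ _).1 hx
    refine ⟨g.hom (1 : R), fun a => ?_⟩
    have : g.hom (a : R) = f a := LinearMap.congr_fun (congrArg ModuleCat.Hom.hom hg) a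
    rw [← this, ← map_smul]
    exact congrArg g.hom (mul_one (a : R)).symm
  · intro h
    refine subsingleton_of_forall_eq 0 fun x => ?_
    obtain ⟨y, rfl⟩ := Abelian.Ext.contravariant_sequence_exact₃ hS (ModuleCat.of R M) x
      (Abelian.Ext.eq_zero_of_projective _) (add_zero 1)
    obtain ⟨f, rfl⟩ := (Abelian.Ext.mk₀_bijective _ _).2 y
    obtain ⟨m, hm⟩ := h f.hom
    have hf : f = S.f ≫ ModuleCat.ofHom (LinearMap.toSpanSingleton R M m) := by
      ext a
      exact hm a
    rw [hf, ← Abelian.Ext.mk₀_comp_mk₀, hS.extClass_comp_assoc]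

theorem isWModule_iff (M : Type u) [AddCommGroup M] [Module R M] :
    IsWModule R M ↔ IsGVTorsionFree R M ∧
      ∀ J ∈ GV R, ∀ f : J →ₗ[R] M, ∃ m : M, ∀ a : J, f a = (a : R) • m := by
  simp_rw [IsWModule, subsingleton_ext_quotient_iff]

theorem isWModule_self : IsWModule R R := by
  refine (isWModule_iff R).2 ⟨isGVTorsionFree_self, fun J hJ f => ?_⟩
  obtain ⟨r, hr⟩ := hJ.2.2 f
  exact ⟨r, fun a => by rw [← hr, toHom_apply, smul_eq_mul, mul_comm]⟩

/-- An ideal is a `w`-module if and only if it is `w`-closed in `R`. -/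
theorem isWModule_ideal_iff {I : Ideal R} : IsWModule R I ↔ wClosure I ≤ I := by
  rw [isWModule_iff]
  constructor
  · rintro ⟨-, h⟩ x hx
    obtain ⟨J, hJ, hJx⟩ := mem_wClosure.1 hx
    obtain ⟨m, hm⟩ := h J hJ (((LinearMap.toSpanSingleton R R x).comp J.subtype).codRestrict I
      fun a => by simpa using hJx a a.2)
    have : x = m := by
      rw [← sub_eq_zero]
      refine isDense_of_mem_GV hJ _ fun a ha => ?_
      rw [mul_sub, sub_eq_zero]
      simpa using congrArg Subtype.val (hm ⟨a, ha⟩)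
    rw [this]
    exact m.2
  · refine fun h => ⟨isGVTorsionFree_iff.2 fun J hJ x hx => Subtype.ext
      (isDense_of_mem_GV hJ _ fun a ha => congrArg Subtype.val (hx a ha)), fun J hJ f => ?_⟩
    obtain ⟨r, hr⟩ := hJ.2.2 (I.subtype.comp f)
    have hr' (a : J) : (f a : R) = a * r := by
      rw [mul_comm]
      exact (LinearMap.congr_fun hr a).symm
    exact ⟨⟨r, h (mem_wClosure.2 ⟨J, hJ, fun a ha => hr' ⟨a, ha⟩ ▸ (f ⟨a, ha⟩).2⟩)⟩,
      fun a => Subtype.ext (hr' a)⟩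

end WModules

/-! ### Maximal `w`-ideals and localization -/

section MaximalWIdeals

variable {R : Type u} [CommRing R]

theorem isMaximalWIdeal_iff {m : Ideal R} :
    IsMaximalWIdeal R m ↔ Maximal (fun I : Ideal R => I ≠ ⊤ ∧ wClosure I ≤ I) m := by
  simp_rw [IsMaximalWIdeal, isWModule_ideal_iff]

theorem IsMaximalWIdeal.not_le {m J : Ideal R} (hm : IsMaximalWIdeal R m) (hJ : J ∈ GV R) :
    ¬ J ≤ m := fun hle => by
  obtain ⟨⟨hne, hw⟩, -⟩ := isMaximalWIdeal_iff.1 hm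
  exact hne (top_le_iff.1 (wClosure_eq_top_iff.2 ⟨J, hJ, hle⟩ ▸ hw))

/-- If `a ∉ m`, then `(m : a)` is a proper `w`-ideal containing `m`, hence equal to `m`. -/
theorem IsMaximalWIdeal.isPrime {m : Ideal R} (hm : IsMaximalWIdeal R m) : m.IsPrime := by
  obtain ⟨⟨hne, hw⟩, hmax⟩ := isMaximalWIdeal_iff.1 hm
  refine ⟨hne, fun {a b} hab => or_iff_not_imp_left.2 fun ha => ?_⟩
  let C : Ideal R := Submodule.comap (LinearMap.mulLeft R a) m
  have hC : ∀ x, x ∈ C ↔ a * x ∈ m := fun x => Iff.rfl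
  refine hmax (y := C) ⟨fun h => ?_, fun x hx => ?_⟩ (fun x hx => m.mul_mem_left a hx) hab
  · have := (hC 1).1 (h ▸ Submodule.mem_top)
    exact ha (by simpa using this)
  · obtain ⟨J, hJ, h⟩ := mem_wClosure.1 hx
    refine hw (mem_wClosure.2 ⟨J, hJ, fun c hc => ?_⟩)
    rw [LinearMap.mulLeft_apply, mul_left_comm]
    exact h c hc

/-- An ideal containing no GV-ideal lies in a maximal `w`-ideal. Zorn's lemma applies to the ideals
without GV-subideals since GV-ideals are finitely generated, and a maximal such ideal is
`w`-closed. -/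
theorem exists_le_isMaximalWIdeal {I : Ideal R} (hI : ∀ J ∈ GV R, ¬ J ≤ I) :
    ∃ m, IsMaximalWIdeal R m ∧ I ≤ m := by
  have hchain : ∀ c ⊆ {K : Ideal R | ∀ J ∈ GV R, ¬ J ≤ K}, IsChain (· ≤ ·) c → ∀ y ∈ c,
      ∃ ub ∈ {K : Ideal R | ∀ J ∈ GV R, ¬ J ≤ K}, ∀ z ∈ c, z ≤ ub := by
    refine fun c hc hchain y hy => ⟨sSup c, fun J hJ hle => ?_, fun z => le_sSup⟩
    obtain ⟨K, hK, hJK⟩ := (CompleteLattice.isCompactElement_iff_le_of_directed_sSup_le _ _).1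
      ((Submodule.fg_iff_compact J).1 hJ.1) c ⟨y, hy⟩ hchain.directedOn hle
    exact hc hK J hJ hJK
  obtain ⟨m, hIm, hm⟩ := zorn_le_nonempty₀ _ hchain I hI
  refine ⟨m, isMaximalWIdeal_iff.2 ⟨⟨fun h => hm.1 ⊤ top_mem_GV h.ge, ?_⟩, ?_⟩, hIm⟩
  · refine hm.2 (y := wClosure m) (fun J hJ hle => ?_) (le_wClosure m)
    obtain ⟨K, hK, hKm⟩ := wClosure_eq_top_iff.1 ((Ideal.eq_top_iff_one _).2
      (mem_wClosure_of_forall_mul_mem hJ fun a ha => by simpa using hle ha))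
    exact hm.1 K hK hKm
  · rintro K ⟨hK, hKw⟩ hle
    refine hm.2 (fun J hJ hJK => hK ?_) hle
    exact top_le_iff.1 (wClosure_eq_top_iff.2 ⟨J, hJ, hJK⟩ ▸ hKw)

variable {A B : Type u} [AddCommGroup A] [Module R A] [AddCommGroup B] [Module R B]

/-- An element that vanishes in the localization at every maximal `w`-ideal is GV-torsion. -/
theorem exists_GV_smul_eq_zero {x : A}
    (hx : ∀ m : Ideal R, IsMaximalWIdeal R m → ∃ s ∉ m, s • x = 0) :
    ∃ J ∈ GV R, ∀ a ∈ J, a • x = 0 := by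
  by_contra! h
  obtain ⟨m, hm, hle⟩ := exists_le_isMaximalWIdeal
    (I := LinearMap.ker (LinearMap.toSpanSingleton R A x)) fun J hJ hle => by
      obtain ⟨a, ha, hax⟩ := h J hJ
      exact hax (hle ha)
  obtain ⟨s, hs, hsx⟩ := hx m hm
  exact hs (hle hsx)

theorem locMap_mk (p : Ideal R) [p.IsPrime] (f : A →ₗ[R] B) (a : A) (s : p.primeCompl) :
    locMap R p f (LocalizedModule.mk a s) = LocalizedModule.mk (f a) s := by
  rw [locMap, IsLocalizedModule.mk_eq_mk', IsLocalizedModule.mk_eq_mk', IsLocalizedModule.map_mk']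

/-- The kernel of a `w`-monomorphism is GV-torsion. -/
theorem IsWMono.exists_GV_smul_eq_zero {f : A →ₗ[R] B} (hf : IsWMono R f) {x : A}
    (hx : f x = 0) : ∃ J ∈ GV R, ∀ a ∈ J, a • x = 0 := by
  refine WQ.exists_GV_smul_eq_zero fun m hm => ?_
  have := hm.isPrime
  have h : LocalizedModule.mk x (1 : m.primeCompl) = 0 := by
    apply hf m hm
    rw [locMap_mk, hx, LocalizedModule.zero_mk, map_zero]
  obtain ⟨s, hs⟩ := LocalizedModule.mk_eq.1 (h.trans (LocalizedModule.zero_mk 1).symm)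
  exact ⟨s, s.2, by simpa [Submonoid.smul_def] using hs⟩

/-- The cokernel of a `w`-epimorphism is GV-torsion. -/
theorem IsWEpi.exists_GV_smul_mem_range {f : A →ₗ[R] B} (hf : IsWEpi R f) (y : B) :
    ∃ J ∈ GV R, ∀ a ∈ J, a • y ∈ LinearMap.range f := by
  suffices ∃ J ∈ GV R, ∀ a ∈ J, a • (LinearMap.range f).mkQ y = 0 by
    simpa [← Submodule.Quotient.mk_smul, -map_smul] using this
  refine WQ.exists_GV_smul_eq_zero fun m hm => ?_
  have := hm.isPrime
  obtain ⟨z, hz⟩ := hf m hm (LocalizedModule.mk y 1)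
  induction z using LocalizedModule.induction_on with
  | h x s =>
    rw [locMap_mk, LocalizedModule.mk_eq] at hz
    obtain ⟨t, ht⟩ := hz
    refine ⟨t * s, (t * s).2, ?_⟩
    rw [← map_smul, Submodule.mkQ_apply, Submodule.Quotient.mk_eq_zero]
    refine ⟨t.1 • x, ?_⟩
    rw [mul_smul, map_smul]
    simpa [Submonoid.smul_def] using ht

theorem isWMono_of_injective {f : A →ₗ[R] B} (hf : Function.Injective f) : IsWMono R f :=
  fun m _ _ => IsLocalizedModule.map_injective m.primeCompl _ _ f hf

end MaximalWIdeals

/-! ### The condition `I ⊆ (I²)_w` -/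

section IdempotentUpToW

variable {R : Type u} [CommRing R]

theorem map_injEnvι_le_wEnvelope_iff {I K : Ideal R} :
    Submodule.map (injEnvι R R) I ≤ wEnvelope R K ↔ I ≤ wClosure K := by
  rw [Submodule.map_le_iff_le_comap]
  refine forall₂_congr fun x _ => ?_
  rw [mem_wClosure]
  refine exists_congr fun J => and_congr_right fun _ => forall₂_congr fun a _ => ?_
  rw [← map_smul, Submodule.mem_map]
  refine ⟨fun ⟨y, hy, h⟩ => ?_, fun h => ⟨_, h, rfl⟩⟩
  rwa [(injEnv_spec R R).injective h] at hy

/-- By the determinant trick, `j I ⊆ I²` makes some monic polynomial in `j`, with lower coefficients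
in `I`, annihilate `I`. -/
theorem exists_pow_mem_of_forall_mul_mem_sq {I : Ideal R} (hI : I ∈ Q R) {j : R}
    (hj : ∀ x ∈ I, j * x ∈ I ^ 2) : j ∈ I.radical := by
  have : Module.Finite R I := Module.Finite.iff_fg.2 hI.1
  obtain ⟨p, hp, -, hcoeff, h0⟩ :=
    LinearMap.exists_monic_and_natDegree_eq_and_coeff_mem_pow_and_aeval_eq_zero R
      (algebraMap R (Module.End R I) j) I (by
        rintro _ ⟨x, rfl⟩
        have h₁ : j * x ∈ (I • (⊤ : Submodule R I)).map I.subtype := by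
          rw [Submodule.map_smul'', Submodule.map_top, Submodule.range_subtype, smul_eq_mul, ← sq]
          exact hj x x.2
        obtain ⟨y, hy, hyx⟩ := h₁
        rwa [show algebraMap R (Module.End R I) j x = y from Subtype.ext hyx.symm])
  rw [Polynomial.aeval_algebraMap_apply] at h0
  have hp0 : p.eval j = 0 := by
    refine isDense_of_mem_Q hI _ fun a ha => ?_
    rw [mul_comm]
    simpa using congrArg Subtype.val (LinearMap.congr_fun h0 ⟨a, ha⟩)
  refine ⟨p.natDegree, ?_⟩
  rw [Polynomial.eval_eq_sum_range, Finset.sum_range_succ, hp.coeff_natDegree, one_mul] at hp0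
  rw [eq_neg_of_add_eq_zero_right hp0]
  refine I.neg_mem (I.sum_mem fun i hi => I.mul_mem_right _ ?_)
  exact Ideal.pow_le_self (Nat.sub_pos_of_lt (Finset.mem_range.1 hi)).ne' (hcoeff i)

theorem mem_GV_of_le_wClosure_sq {I : Ideal R} (hI : I ∈ Q R) (h : I ≤ wClosure (I ^ 2)) :
    I ∈ GV R := by
  obtain ⟨J, hJ, hle⟩ := exists_GV_mul_le_of_le_wClosure hI.1 h
  have hrad : J ≤ I.radical := fun j hj =>
    exists_pow_mem_of_forall_mul_mem_sq hI fun x hx => hle (Ideal.mul_mem_mul hj hx)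
  obtain ⟨n, hn⟩ := Ideal.exists_pow_le_of_le_radical_of_fg hrad hJ.1
  exact mem_GV_of_le (GV_pow hJ n) hI.1 hn

end IdempotentUpToW

/-! ### `w`-flatness of `R ⧸ I` -/

section WFlat

open TensorProduct

variable {R : Type u} [CommRing R]

theorem smul_tensor_quotient_eq_zero {I : Ideal R} {A : Type u} [AddCommGroup A] [Module R A]
    {s : R} (hs : s ∈ I) (z : A ⊗[R] (R ⧸ I)) : s • z = 0 := by
  induction z with
  | zero => exact smul_zero s
  | add x y hx hy => rw [smul_add, hx, hy, add_zero]
  | tmul a r =>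
    obtain ⟨r, rfl⟩ := I.mkQ_surjective r
    have h : I.mkQ (s • r) = 0 := (Submodule.Quotient.mk_eq_zero I).2 (I.mul_mem_right r hs)
    rw [← TensorProduct.tmul_smul, ← map_smul, h, TensorProduct.tmul_zero]

/-- A GV-ideal lies in no maximal `w`-ideal, so `A ⊗ R/I` localizes to zero at every
maximal `w`-ideal. -/
theorem isWFlat_quotient_of_mem_GV {I : Ideal R} (hI : I ∈ GV R) : IsWFlat R (R ⧸ I) := by
  intro A B _ _ _ _ f _ m _ hm
  obtain ⟨s, hs, hsm⟩ := SetLike.not_le_iff_exists.1 (hm.not_le hI)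
  refine fun x y _ => ?_
  suffices ∀ z : LocalizedModule m.primeCompl (A ⊗[R] (R ⧸ I)), z = 0 by rw [this x, this y]
  intro z
  induction z using LocalizedModule.induction_on with
  | h z t =>
    rw [← LocalizedModule.zero_mk 1, LocalizedModule.mk_eq]
    refine ⟨⟨s, hsm⟩, ?_⟩
    rw [smul_zero, smul_zero, one_smul]
    exact smul_tensor_quotient_eq_zero hs z

/-- Tensoring the monomorphism `I → R` with `R/I` gives the zero map `I/I² → R/I`. -/
theorem le_wClosure_sq_of_isWFlat_quotient {I : Ideal R} (hI : IsWFlat R (R ⧸ I)) :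
    I ≤ wClosure (I ^ 2) := by
  intro x hx
  have hmono := hI I R I.subtype (isWMono_of_injective I.injective_subtype)
  obtain ⟨J, hJ, h⟩ := hmono.exists_GV_smul_eq_zero (x := (⟨x, hx⟩ : I) ⊗ₜ (1 : R ⧸ I)) (by
    have : x ⊗ₜ[R] (1 : R ⧸ I) = x • ((1 : R) ⊗ₜ[R] (1 : R ⧸ I)) := by
      rw [TensorProduct.smul_tmul', smul_eq_mul, mul_one]
    rw [LinearMap.rTensor_tmul, Submodule.subtype_apply, this]
    exact smul_tensor_quotient_eq_zero hx _)
  refine mem_wClosure.2 ⟨J, hJ, fun a ha => ?_⟩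
  have h₁ := congrArg (TensorProduct.tensorQuotEquivQuotSMul I I) (h a ha)
  rw [TensorProduct.smul_tmul', map_zero, ← map_one (Ideal.Quotient.mk I),
    TensorProduct.tensorQuotEquivQuotSMul_tmul_mk, one_smul, Submodule.Quotient.mk_eq_zero] at h₁
  have h₂ := Submodule.mem_map_of_mem (f := I.subtype) h₁
  rwa [Submodule.map_smul'', Submodule.map_top, Submodule.range_subtype, smul_eq_mul, ← sq] at h₂

end WFlat

/-! ### Lucas modules -/

section Lucas

variable {R : Type u} [CommRing R]

theorem IsWQRing.isLucas (hR : IsWQRing R) {M : Type u} [AddCommGroup M] [Module R M]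
    (hM : IsWModule R M) : IsLucas R M := by
  obtain ⟨htf, hext⟩ := (isWModule_iff M).1 hM
  have htf := isGVTorsionFree_iff.1 htf
  have hE := injEnv_spec R M
  refine ⟨fun I hI m hm => htf I (hR I hI) m hm, le_antisymm ?_ ?_⟩
  · rintro x ⟨I, hI, hx⟩
    -- the map `a ↦ a • x` from `I` to `M` is multiplication by some `m : M`
    let e := LinearEquiv.ofInjective (injEnvι R M) hE.injective
    let φ : I →ₗ[R] LinearMap.range (injEnvι R M) :=
      ((LinearMap.toSpanSingleton R (injEnv R M) x).comp I.subtype).codRestrict _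
        fun a => by simpa using! hx a a.2
    obtain ⟨m, hm⟩ := hext I (hR I hI) (e.symm.toLinearMap.comp φ)
    have hm' : ∀ a ∈ I, a • (x - injEnvι R M m) = 0 := fun a ha => by
      rw [smul_sub, sub_eq_zero, ← map_smul, ← hm ⟨a, ha⟩]
      exact (congrArg Subtype.val (e.apply_symm_apply (φ ⟨a, ha⟩))).symm
    refine ⟨m, ?_⟩
    by_contra hne
    -- essentiality turns a nonzero GV-torsion element of the envelope into one of `M`
    obtain ⟨r, hr0, n, hn⟩ := hE.essential (x - injEnvι R M m)
      fun h => hne (sub_eq_zero.1 h).symm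
    refine hr0 ?_
    rw [← hn, htf I (hR I hI) n fun a ha => hE.injective ?_, map_zero]
    rw [map_smul, hn, smul_comm, hm' a ha, smul_zero, map_zero]
  · rintro _ ⟨m, rfl⟩
    exact ⟨⊤, top_mem_Q, fun a _ => ⟨a • m, map_smul _ _ _⟩⟩

theorem isWQRing_of_isLucas_self (h : IsLucas R R) : IsWQRing R := by
  refine fun I hI => (mem_GV_iff_of_mem_Q hI).2 fun f => ?_
  have hE := injEnv_spec R R
  -- `f` is multiplication by some `x` in the injective envelope of `R`
  obtain ⟨g, hg⟩ := hE.injective_module.out I.subtype I.injective_subtype ((injEnvι R R).comp f)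
  have hg' (a : I) : (a : R) • g 1 = injEnvι R R (f a) := by
    rw [← map_smul, smul_eq_mul, mul_one]
    exact hg a
  obtain ⟨r, hr⟩ : g 1 ∈ LinearMap.range (injEnvι R R) :=
    h.2 ▸ ⟨I, hI, fun a ha => ⟨f ⟨a, ha⟩, (hg' ⟨a, ha⟩).symm⟩⟩
  refine ⟨r, LinearMap.ext fun a => hE.injective ?_⟩
  rw [toHom_apply, ← hg', ← hr, ← map_smul, smul_eq_mul, mul_comm]

end Lucas

/-! ### The ring of finite fractions -/

section FiniteFractions

open Polynomial

variable {R : Type u} [CommRing R]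

/-- The coefficients `g` are generators of `I`. By McCoy's theorem, a polynomial whose coefficients
generate a dense ideal is a nonzerodivisor. -/
theorem exists_regular_polynomial_of_mem_Q {I : Ideal R} (hI : I ∈ Q R) :
    ∃ (n : ℕ) (g : Fin n → I), ∑ i : Fin n, monomial (i : ℕ) (g i : R) ∈ nonZeroDivisors R[X] := by
  obtain ⟨n, g, hg⟩ := Submodule.fg_iff_exists_fin_generating_family.1 hI.1
  refine ⟨n, fun i => ⟨g i, hg ▸ Submodule.subset_span ⟨i, rfl⟩⟩,
    Polynomial.mem_nonZeroDivisors_iff.2 fun a ha => isDense_of_mem_Q hI a fun b hb => ?_⟩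
  rw [← hg] at hb
  induction hb using Submodule.span_induction with
  | mem x hx =>
    obtain ⟨i, rfl⟩ := hx
    have := congrArg (coeff · (i : ℕ)) ha
    simpa [finsetSum_coeff, coeff_monomial, Fin.val_inj, mul_comm] using this
  | zero => simp
  | add x y _ _ hx hy => rw [add_mul, hx, hy, add_zero]
  | smul r x _ hx => rw [smul_eq_mul, mul_assoc, hx, mul_zero]

theorem algebraMap_fractionRing_polynomial_injective :
    Function.Injective (algebraMap R (FractionRing R[X])) := by
  rw [IsScalarTower.algebraMap_eq R R[X] (FractionRing R[X])]
  exact (IsFractionRing.injective R[X] (FractionRing R[X])).comp C_injective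

theorem algebraMap_fractionRing_monomial (i : ℕ) (a : R) :
    algebraMap R[X] (FractionRing R[X]) (monomial i a) =
      algebraMap R (FractionRing R[X]) a * algebraMap R[X] (FractionRing R[X]) (X ^ i) := by
  rw [← C_mul_X_pow_eq_monomial, map_mul, IsScalarTower.algebraMap_apply R R[X], algebraMap_eq]

/-- An ideal of `𝒬` has no nonzero annihilator in `T(R[x])`. -/
theorem eq_zero_of_forall_algebraMap_mul_eq_zero {I : Ideal R} (hI : I ∈ Q R)
    {β : FractionRing R[X]} (h : ∀ a ∈ I, algebraMap R (FractionRing R[X]) a * β = 0) : β = 0 := by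
  obtain ⟨n, g, hg⟩ := exists_regular_polynomial_of_mem_Q hI
  refine (IsLocalization.map_units (FractionRing R[X]) ⟨_, hg⟩).mul_right_eq_zero.1 ?_
  rw [map_sum, Finset.sum_mul]
  refine Finset.sum_eq_zero fun i _ => ?_
  rw [algebraMap_fractionRing_monomial, mul_right_comm, h _ (g i).2, zero_mul]

theorem IsWQRing.Q₀_eq_bot (hR : IsWQRing R) : Q₀ R = ⊥ := by
  refine eq_bot_iff.2 ?_
  rintro α ⟨I, hI, hα⟩
  choose! φ hφ using hα
  let φ' : I →ₗ[R] R :=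
    { toFun := fun a => φ a
      map_add' := fun a b => algebraMap_fractionRing_polynomial_injective (by
        rw [map_add, hφ _ a.2, hφ _ b.2, hφ _ (a + b).2, Submodule.coe_add, map_add, add_mul])
      map_smul' := fun r a => algebraMap_fractionRing_polynomial_injective (by
        rw [RingHom.id_apply, smul_eq_mul, map_mul, hφ _ a.2, hφ _ (r • a).2, Submodule.coe_smul,
          smul_eq_mul, map_mul, mul_assoc]) }
  obtain ⟨r, hr⟩ := (hR I hI).2.2 φ'
  refine Algebra.mem_bot.2 ⟨r, Eq.symm (sub_eq_zero.1
    (eq_zero_of_forall_algebraMap_mul_eq_zero hI fun a ha => ?_))⟩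
  have h : r * a = φ a := LinearMap.congr_fun hr ⟨a, ha⟩
  rw [mul_sub, ← hφ a ha, ← h, map_mul, mul_comm, sub_self]

/-- A homomorphism `φ : I → R` with `I = (a₀, …, aₙ)` is multiplication by the finite fraction
`(∑ φ(aᵢ) xⁱ) / (∑ aᵢ xⁱ)`. -/
theorem isWQRing_of_Q₀_eq_bot (h : Q₀ R = ⊥) : IsWQRing R := by
  refine fun I hI => (mem_GV_iff_of_mem_Q hI).2 fun φ => ?_
  obtain ⟨n, g, hg⟩ := exists_regular_polynomial_of_mem_Q hI
  let α : FractionRing R[X] :=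
    IsLocalization.mk' _ (∑ i : Fin n, monomial (i : ℕ) (φ (g i))) ⟨_, hg⟩
  have hα : ∀ a : I, algebraMap R (FractionRing R[X]) a * α = algebraMap R _ (φ a) := by
    intro a
    rw [IsScalarTower.algebraMap_apply R R[X], IsScalarTower.algebraMap_apply R R[X] _ (φ a),
      IsLocalization.mul_mk'_eq_mk'_of_mul, IsLocalization.mk'_eq_iff_eq_mul, ← map_mul]
    congr 1
    simp only [Finset.mul_sum, algebraMap_eq, C_mul_monomial]
    refine Finset.sum_congr rfl fun i _ => ?_
    congr 1
    rw [← smul_eq_mul, ← map_smul, mul_comm, ← smul_eq_mul, ← map_smul]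
    congr 1
    ext
    exact mul_comm _ _
  obtain ⟨r, hr⟩ : α ∈ (⊥ : Subalgebra R (FractionRing R[X])) :=
    h ▸ (⟨I, hI, fun a ha => ⟨φ ⟨a, ha⟩, (hα ⟨a, ha⟩).symm⟩⟩ : α ∈ Q₀ R)
  refine ⟨r, LinearMap.ext fun a => algebraMap_fractionRing_polynomial_injective ?_⟩
  rw [toHom_apply, ← hα, map_mul, mul_comm]
  exact congrArg _ hr

end FiniteFractions

/-! ### `Tor₁(R ⧸ I, M)` through a projective resolution -/

section Tor

open TensorProduct MonoidalCategory

variable {R : Type u} [CommRing R]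

theorem smul_homology_eq_zero (S : ShortComplex (ModuleCat.{u} R)) {a : R}
    (ha : ∀ x : S.X₂, a • x = 0) (h : S.homology) : a • h = 0 := by
  let e : S.homology ≃ₗ[R] LinearMap.ker S.g.hom ⧸ LinearMap.range S.moduleCatToCycles :=
    S.moduleCatHomologyIso.toLinearEquiv
  apply e.injective
  rw [map_smul, map_zero]
  obtain ⟨z, hz⟩ := Submodule.mkQ_surjective _ (e h)
  rw [← hz, ← map_smul, show a • z = 0 from Subtype.ext (ha z.1)]
  exact map_zero _

theorem exists_homology_class (S : ShortComplex (ModuleCat.{u} R)) {z : S.X₂} (hz : S.g z = 0) :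
    ∃ h : S.homology, ∀ s : R, s • h = 0 → ∃ y : S.X₁, S.f y = s • z := by
  let e : S.homology ≃ₗ[R] LinearMap.ker S.g.hom ⧸ LinearMap.range S.moduleCatToCycles :=
    S.moduleCatHomologyIso.toLinearEquiv
  refine ⟨e.symm (Submodule.mkQ (LinearMap.range S.moduleCatToCycles) ⟨z, hz⟩), fun s hs => ?_⟩
  rw [← map_smul, LinearEquiv.map_eq_zero_iff, ← map_smul] at hs
  obtain ⟨y, hy⟩ := (Submodule.Quotient.mk_eq_zero _).1 hs
  exact ⟨y, congrArg Subtype.val hy⟩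

/-- `Tor₁(X, M)` is the homology of `X ⊗ P₂ → X ⊗ P₁ → X ⊗ P₀` for a projective resolution `P`. -/
noncomputable def torOneIso (X : ModuleCat.{u} R) {M : ModuleCat.{u} R}
    (P : ProjectiveResolution M) :
    ((Tor (ModuleCat.{u} R) 1).obj X).obj M ≅
      ((((tensoringLeft (ModuleCat.{u} R)).obj X).mapHomologicalComplex _).obj P.complex
        |>.sc' 2 1 0).homology :=
  P.isoLeftDerivedObj ((tensoringLeft (ModuleCat.{u} R)).obj X) 1 ≪≫
    HomologicalComplex.homologyIsoSc' _ 2 1 0 (by simp) (by simp)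

theorem smul_tor_eq_zero {X : ModuleCat.{u} R} {a : R} (ha : ∀ x : X, a • x = 0)
    (M : ModuleCat.{u} R) (t : ((Tor (ModuleCat.{u} R) 1).obj X).obj M) : a • t = 0 := by
  let e := (torOneIso X (projectiveResolution M)).toLinearEquiv
  apply e.injective
  rw [map_smul, map_zero]
  refine smul_homology_eq_zero _ (fun z => ?_) _
  change X ⊗[R] ((projectiveResolution M).complex.X 1) at z
  change a • z = 0
  induction z with
  | zero => exact smul_zero a
  | add x y hx hy => rw [smul_add, hx, hy, add_zero]
  | tmul x y => rw [TensorProduct.smul_tmul', ha, TensorProduct.zero_tmul]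

theorem IsWQRing.isSRWFlat (hR : IsWQRing R) (M : Type u) [AddCommGroup M] [Module R M] :
    IsSRWFlat R M := by
  refine fun I hI => isGVTorsion_iff.2 fun t => ⟨I, hR I hI, fun a ha => ?_⟩
  refine smul_tor_eq_zero (fun x => ?_) _ t
  obtain ⟨r, rfl⟩ := I.mkQ_surjective x
  rw [← map_smul]
  exact (Submodule.Quotient.mk_eq_zero I).2 (I.mul_mem_right r ha)

theorem exists_GV_smul_mem_range_lTensor {X : ModuleCat.{u} R} {M : ModuleCat.{u} R}
    (hT : IsGVTorsion R (((Tor (ModuleCat.{u} R) 1).obj X).obj M)) (P : ProjectiveResolution M)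
    {z : X ⊗[R] P.complex.X 1} (hz : (P.complex.d 1 0).hom.lTensor X z = 0) :
    ∃ J ∈ GV R, ∀ s ∈ J, s • z ∈ LinearMap.range ((P.complex.d 2 1).hom.lTensor X) := by
  let e := (torOneIso X P).toLinearEquiv
  obtain ⟨h, hh⟩ := exists_homology_class
    ((((tensoringLeft (ModuleCat.{u} R)).obj X).mapHomologicalComplex _).obj P.complex
        |>.sc' 2 1 0) (z := z) hz
  obtain ⟨J, hJ, hJh⟩ := isGVTorsion_iff.1 hT (e.symm h)
  refine ⟨J, hJ, fun s hs => ?_⟩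
  obtain ⟨y, hy⟩ := hh s (by
    have := hJh s hs
    rwa [← map_smul, LinearEquiv.map_eq_zero_iff] at this)
  exact ⟨y, hy⟩

/-- The kernel of `M → R/I ⊗ M`, `x ↦ 1 ⊗ x`, is `I M`. -/
theorem one_tmul_eq_zero_iff (I : Ideal R) {M : Type u} [AddCommGroup M] [Module R M] {x : M} :
    (1 : R ⧸ I) ⊗ₜ[R] x = 0 ↔ x ∈ I • (⊤ : Submodule R M) := by
  rw [← map_one (Ideal.Quotient.mk I), ← (quotTensorEquivQuotSMul M I).map_eq_zero_iff]
  simp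

theorem exists_one_tmul_eq (I : Ideal R) {M : Type u} [AddCommGroup M] [Module R M]
    (z : (R ⧸ I) ⊗[R] M) : ∃ x : M, (1 : R ⧸ I) ⊗ₜ[R] x = z := by
  induction z with
  | zero => exact ⟨0, TensorProduct.tmul_zero _ _⟩
  | add y z hy hz =>
    obtain ⟨y, rfl⟩ := hy
    obtain ⟨z, rfl⟩ := hz
    exact ⟨y + z, TensorProduct.tmul_add _ _ _⟩
  | tmul r x =>
    obtain ⟨r, rfl⟩ := I.mkQ_surjective r
    refine ⟨r • x, ?_⟩
    rw [← TensorProduct.smul_tmul, Algebra.smul_def, mul_one]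
    rfl

/-- Suppose `Tor₁(R/I, F)` is GV-torsion. A relation `u • y = 0` with `u ∈ I` gives a class in
`Tor₁(R/I, F)`, which a linear map `ε : F → R/I` with `ε y = j` sends to the class of `u * j` in
`Tor₁(R/I, R/I) = I/I²`; that class is therefore GV-torsion. -/
theorem mul_mem_wClosure_sq_of_isGVTorsion_tor {I : Ideal R} {F : Type u} [AddCommGroup F]
    [Module R F] (hT : IsGVTorsion R
      (((Tor (ModuleCat.{u} R) 1).obj (ModuleCat.of R (R ⧸ I))).obj (ModuleCat.of R F)))
    (ε : F →ₗ[R] R ⧸ I) {y : F} {u j : R} (hu : u ∈ I) (huy : u • y = 0)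
    (hj : ε y = Ideal.Quotient.mk I j) : u * j ∈ wClosure (I ^ 2) := by
  let P := projectiveResolution (ModuleCat.of R F)
  let π : P.complex.X 0 ⟶ ModuleCat.of R F := P.π.f 0
  have hdπ : P.complex.d 1 0 ≫ π = 0 := P.complex_d_comp_π_f_zero
  have hdd : P.complex.d 2 1 ≫ P.complex.d 1 0 = 0 := P.complex.d_comp_d 2 1 0
  have hex : (ShortComplex.mk (P.complex.d 1 0) π hdπ).Exact := P.exact₀
  have hπ : Function.Surjective π := (ModuleCat.epi_iff_surjective π).1
    (inferInstanceAs (Epi (P.π.f 0)))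
  -- `g : P₀ → R` lifts `ε ∘ π`
  have hmk : Epi (ModuleCat.ofHom I.mkQ) := (ModuleCat.epi_iff_surjective _).2 I.mkQ_surjective
  have := P.projective 0
  let g : P.complex.X 0 ⟶ ModuleCat.of R R :=
    Projective.factorThru (π ≫ ModuleCat.ofHom ε) (ModuleCat.ofHom I.mkQ)
  have hg (x : P.complex.X 0) : Ideal.Quotient.mk I (g.hom x) = ε (π.hom x) :=
    LinearMap.congr_fun (congrArg ModuleCat.Hom.hom
      (Projective.factorThru_comp (π ≫ ModuleCat.ofHom ε) (ModuleCat.ofHom I.mkQ))) x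
  -- lift `y` to `y' : P₀` and write `u • y'` as a boundary
  obtain ⟨y', rfl⟩ := hπ y
  obtain ⟨p, hp⟩ : ∃ p, (P.complex.d 1 0).hom p = u • y' :=
    (ShortComplex.moduleCat_exact_iff _).1 hex (u • y') ((map_smul π.hom u y').trans huy)
  obtain ⟨J, hJ, h⟩ := exists_GV_smul_mem_range_lTensor hT P (z := (1 : R ⧸ I) ⊗ₜ p) (by
    rw [LinearMap.lTensor_tmul, hp]
    exact (one_tmul_eq_zero_iff I).2 (Submodule.smul_mem_smul hu trivial))
  refine mem_wClosure.2 ⟨J, hJ, fun s hs => ?_⟩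
  obtain ⟨w, hw⟩ := h s hs
  obtain ⟨q, rfl⟩ := exists_one_tmul_eq I w
  have hq : s • p - (P.complex.d 2 1).hom q ∈ I • (⊤ : Submodule R (P.complex.X 1)) := by
    rw [← one_tmul_eq_zero_iff, TensorProduct.tmul_sub, TensorProduct.tmul_smul, ← hw]
    exact sub_self _
  let k : P.complex.X 1 →ₗ[R] R := g.hom ∘ₗ (P.complex.d 1 0).hom
  have hk : LinearMap.range k ≤ I := by
    rintro _ ⟨x, rfl⟩
    rw [← Ideal.Quotient.eq_zero_iff_mem]
    refine (hg _).trans ?_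
    rw [show π.hom ((P.complex.d 1 0).hom x) = 0 from
      LinearMap.congr_fun (congrArg ModuleCat.Hom.hom hdπ) x, map_zero]
  have h₁ : k (s • p - (P.complex.d 2 1).hom q) ∈ I ^ 2 := by
    have := Submodule.mem_map_of_mem (f := k) hq
    rw [Submodule.map_smul'', Submodule.map_top] at this
    rw [sq]
    exact smul_mono_right I hk this
  have h₂ : k ((P.complex.d 2 1).hom q) = 0 := by
    rw [LinearMap.comp_apply, show (P.complex.d 1 0).hom ((P.complex.d 2 1).hom q) = 0 from
      LinearMap.congr_fun (congrArg ModuleCat.Hom.hom hdd) q, map_zero]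
  have h₃ : k p = u * g.hom y' := by
    rw [LinearMap.comp_apply, hp, map_smul, smul_eq_mul]
  rw [map_sub, h₂, sub_zero, map_smul, h₃, smul_eq_mul] at h₁
  -- `g y'` and `j` agree modulo `I`
  have h₄ : g.hom y' - j ∈ I := Ideal.Quotient.eq.1 ((hg y').trans hj)
  have h₅ : s * (u * (g.hom y' - j)) ∈ I ^ 2 :=
    Ideal.mul_mem_left _ _ (sq I ▸ Ideal.mul_mem_mul hu h₄)
  have : s * (u * j) = s * (u * g.hom y') - s * (u * (g.hom y' - j)) := by ring
  rw [this]
  exact sub_mem h₁ h₅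

end Tor

/-! ### The weak global dimension -/

section GlobalDim

variable {R : Type u} [CommRing R]

theorem isWEpi_of_surjective {A B : Type u} [AddCommGroup A] [Module R A] [AddCommGroup B]
    [Module R B] {f : A →ₗ[R] B} (hf : Function.Surjective f) : IsWEpi R f :=
  fun m _ _ => IsLocalizedModule.map_surjective m.primeCompl _ _ f hf

theorem isWExact_of_exact {A B C : Type u} [AddCommGroup A] [Module R A] [AddCommGroup B]
    [Module R B] [AddCommGroup C] [Module R C] {f : A →ₗ[R] B} {g : B →ₗ[R] C}
    (h : Function.Exact f g) : IsWExact R f g :=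
  fun m _ _ => IsLocalizedModule.map_exact m.primeCompl _ _ _ f g h

theorem exists_resolution_of_isSRWFlat {M : Type u} [AddCommGroup M] [Module R M]
    (hM : IsSRWFlat R M) : Nonempty (SRWResolution R M 0) := by
  refine ⟨{
    F
      | 0 => ModuleCat.of R M
      | _ + 1 => ModuleCat.of R PUnit
    d := fun _ => 0
    ε := (LinearMap.id : M →ₗ[R] M)
    wEpi := isWEpi_of_surjective (f := (LinearMap.id : M →ₗ[R] M)) Function.surjective_id
    wExact_zero := isWExact_of_exact fun x => ?_
    wExact_succ := fun i => isWExact_of_exact fun x => ?_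
    wFlat := fun i hi => absurd hi (Nat.not_lt_zero i)
    srwFlat := hM
    eq_zero := fun i hi => ?_ }⟩
  · simp [eq_comm]
  · exact ⟨fun _ => ⟨PUnit.unit, Subsingleton.elim (α := PUnit) _ _⟩, fun _ => rfl⟩
  · cases i with
    | zero => exact absurd hi (lt_irrefl 0)
    | succ i => exact inferInstanceAs (Subsingleton PUnit)

theorem srwWeakGlobalDim_eq_zero_iff :
    srwWeakGlobalDim R = 0 ↔ ∀ (M : Type u) [AddCommGroup M] [Module R M],
      Nonempty (SRWResolution R M 0) := by
  have key : ∀ M : ModuleCat.{u} R, srwFD R M = 0 ↔ Nonempty (SRWResolution R M 0) := by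
    intro M
    constructor
    · intro h
      have h₁ : srwFD R M < 1 := by rw [h]; exact zero_lt_one
      simp only [srwFD, iInf_lt_iff] at h₁
      obtain ⟨n, hn, hlt⟩ := h₁
      obtain rfl : n = 0 := by simpa using hlt
      exact hn
    · exact fun h => le_antisymm ((iInf₂_le 0 h).trans_eq Nat.cast_zero) zero_le
  rw [srwWeakGlobalDim, ← bot_eq_zero, iSup_eq_bot]
  simp_rw [bot_eq_zero, key]
  exact ⟨fun h M _ _ => h (ModuleCat.of R M), fun h M => h M⟩

/-- A resolution of length zero is a `w`-isomorphism `ε : F → R/I`. Up to GV-torsion, `1 : R/I` lifts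
to some `y : F`, and `x • y = 0` for `x ∈ I`. -/
theorem SRWResolution.le_wClosure_sq {I : Ideal R} (hI : I ∈ Q R) (h : SRWResolution R (R ⧸ I) 0) :
    I ≤ wClosure (I ^ 2) := by
  intro x hx
  have hmono : IsWMono R h.ε := by
    intro m _ hm
    rw [injective_iff_map_eq_zero]
    intro z hz
    obtain ⟨t, rfl⟩ := (h.wExact_zero m hm z).1 hz
    have := h.eq_zero 1 zero_lt_one
    induction t using LocalizedModule.induction_on with
    | h t s => rw [locMap_mk, Subsingleton.elim t 0, map_zero, LocalizedModule.zero_mk]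
  obtain ⟨J, hJ, hJr⟩ := h.wEpi.exists_GV_smul_mem_range 1
  refine mem_wClosure_of_forall_mul_mem hJ fun j hj => ?_
  obtain ⟨y, hy⟩ := hJr j hj
  have hy' : h.ε y = Ideal.Quotient.mk I j := by
    rw [hy, Algebra.smul_def, mul_one]
    rfl
  obtain ⟨K, hK, hKxy⟩ := hmono.exists_GV_smul_eq_zero (x := x • y) (by
    rw [map_smul, hy', Algebra.smul_def]
    exact (map_mul (Ideal.Quotient.mk I) x j).symm.trans
      (Ideal.Quotient.eq_zero_iff_mem.2 (I.mul_mem_right j hx)))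
  refine mem_wClosure_of_forall_mul_mem hK fun t ht => ?_
  rw [mul_left_comm, mul_comm]
  exact mul_mem_wClosure_sq_of_isGVTorsion_tor (h.srwFlat I hI) h.ε (I.mul_mem_left t hx)
    (by rw [mul_smul]; exact hKxy t ht) hy'

end GlobalDim

end WQ

theorem theorem4p2 (R : Type u) [CommRing R] :
    List.TFAE [
      WQ.IsWQRing R,
      ∀ (M : Type u) [AddCommGroup M] [Module R M], WQ.IsSRWFlat R M,
      WQ.srwWeakGlobalDim R = 0,
      ∀ I ∈ WQ.Q R, WQ.IsWFlat R (R ⧸ I),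
      ∀ I ∈ WQ.Q R, Submodule.map (WQ.injEnvι R R) I ≤ WQ.wEnvelope R (I ^ 2),
      ∀ (M : Type u) [AddCommGroup M] [Module R M], WQ.IsWModule R M → WQ.IsLucas R M,
      WQ.Q₀ R = ⊥] := by
  simp_rw [WQ.map_injEnvι_le_wEnvelope_iff]
  tfae_have 1 → 2 := fun h M _ _ => h.isSRWFlat M
  tfae_have 2 → 3 := fun h =>
    WQ.srwWeakGlobalDim_eq_zero_iff.2 fun M _ _ => WQ.exists_resolution_of_isSRWFlat (h M)
  tfae_have 3 → 5 := fun h I hI =>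
    (WQ.srwWeakGlobalDim_eq_zero_iff.1 h (R ⧸ I)).some.le_wClosure_sq hI
  tfae_have 1 → 4 := fun h I hI => WQ.isWFlat_quotient_of_mem_GV (h I hI)
  tfae_have 4 → 5 := fun h I hI => WQ.le_wClosure_sq_of_isWFlat_quotient (h I hI)
  tfae_have 5 → 1 := fun h I hI => WQ.mem_GV_of_le_wClosure_sq hI (h I hI)
  tfae_have 1 → 6 := fun h M _ _ hM => h.isLucas hM
  tfae_have 6 → 1 := fun h => WQ.isWQRing_of_isLucas_self (h R WQ.isWModule_self)
  tfae_have 1 → 7 := fun h => h.Q₀_eq_bot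
  tfae_have 7 → 1 := WQ.isWQRing_of_Q₀_eq_bot
  tfae_finish
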